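/- Let $p$ be a prime, and let $v_p$ be the $p$-adic valuation on $\mathbf C_p$, normalized by $v_p(p)=1$ and with $v_p(0)=+\infty$. For a nonzero power series $F=\sum_{i\ge 0}F_iX^i\in\mathbf C_p[[X]]$ define its characteristic sequence $k_0<k_1<\cdots$ as follows: $k_0$ is the smallest index with $F_{k_0}\neq 0$ (so $k_0=0$ if $F(0)\ne 0$); given $k_{m-1}$, let $k_m$ be the largest integer $n>k_{m-1}$ at which $$l_m(n)=\frac{v_p(F_{k_{m-1}})-v_p(F_n)}{n-k_{m-1}}$$ attains its maximum over all integers $n>k_{m-1}$; if there is no such largest integer, the sequence ends with $k_{m-1}$. The valuation sequence of $F$ is $\alpha_m=\dfrac{v_p(F_{k_{m-1}})-v_p(F_{k_m})}{k_m-k_{m-1}}$ for those $m\ge 1$ for which $k_m$ exists; it is finite (possibly empty) or infinite. The valuation sequence of $F=0$ is empty. Proposition 5.2. Let $D$ be the open unit disc $\{x\in\mathbf C_p: v_p(x)>0\}$ or the closed unit disc $\{x\in\mathbf C_p: v_p(x)\ge 0\}$. Let $F,G\in\mathbf C_p[[X]]$ converge at every point of $D$ and have no common root in $D$, and let $(\alpha_m)$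 and $(\beta_m)$ be their valuation sequences. If the set $\{\alpha_1,\alpha_2,\dots\}\cap\{\beta_1,\beta_2,\dots\}$ is finite, then $$S=\sup_{x\in D}\min\bigl(v_p(F(x)),v_p(G(x))\bigr)<+\infty .$$ -/

import Mathlib

noncomputable section

namespace PadicSeries

variable {p : ℕ} [Fact p.Prime]

open Classical in
/-- The `p`-adic valuation on `ℂ_[p]`, normalized by `v_p(p) = 1`, with `v_p(0) = +∞`. -/
def vp (x : ℂ_[p]) : EReal :=
  if x = 0 then ⊤ else ((-Real.logb (p : ℝ) ‖x‖ : ℝ) : EReal)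

/-- `F` converges at every point of `D`. -/
def ConvergesOn (F : PowerSeries ℂ_[p]) (D : Set ℂ_[p]) : Prop :=
  ∀ x ∈ D, Summable fun i : ℕ => PowerSeries.coeff i F * x ^ i

/-- The value `F(x) = ∑ F_i x^i` (meaningful where the series converges). -/
def eval (F : PowerSeries ℂ_[p]) (x : ℂ_[p]) : ℂ_[p] :=
  ∑' i : ℕ, PowerSeries.coeff i F * x ^ i

/-- The function `l(n) = (v_p(F_k) - v_p(F_n)) / (n - k)`, used for `n > k`. If `F_k ≠ 0`, then
`l(n) = -∞` whenever `F_n = 0`. -/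
def rootSlope (F : PowerSeries ℂ_[p]) (k n : ℕ) : EReal :=
  (vp (PowerSeries.coeff k F) - vp (PowerSeries.coeff n F)) / (((n : ℝ) - (k : ℝ) : ℝ) : EReal)

/-- The integers `n > k` at which `l` attains its maximum over all integers greater than `k`. -/
def maximizers (F : PowerSeries ℂ_[p]) (k : ℕ) : Set ℕ :=
  {n | k < n ∧ ∀ j, k < j → rootSlope F k j ≤ rootSlope F k n}

open Classical in
/-- The largest integer at which `l` attains its maximum; `none` if there is no such integer. -/
def nextIndex (F : PowerSeries ℂ_[p]) (k : ℕ) : Option ℕ :=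
  if h : ∃ n, IsGreatest (maximizers F k) n then some h.choose else none

/-- The characteristic sequence `k_0, k_1, …` of `F`; it is `none` from the step on at which the
algorithm has ended. It starts at the first index with a nonzero coefficient, hence at `k_0 = 0`
when `F(0) ≠ 0`. For `F = 0` it consists of `k_0 = 0` only. -/
def charSeq (F : PowerSeries ℂ_[p]) : ℕ → Option ℕ
  | 0 => some F.order.toNat
  | m + 1 => (charSeq F m).bind (nextIndex F)

/-- The set of the terms `α_m = (v_p(F_{k_{m-1}}) - v_p(F_{k_m})) / (k_m - k_{m-1})`, `m ≥ 1`, of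
the sequence of `p`-adic valuations of the roots of `F`. -/
def rootValuations (F : PowerSeries ℂ_[p]) : Set EReal :=
  {a | ∃ m k k' : ℕ, charSeq F m = some k ∧ charSeq F (m + 1) = some k' ∧ a = rootSlope F k k'}

/-- `φ(x) = min (v_p(F(x)), v_p(G(x)))`. -/
def phi (F G : PowerSeries ℂ_[p]) (x : ℂ_[p]) : EReal :=
  min (vp (eval F x)) (vp (eval G x))

/-- The supremum `S` of `φ` over `D`, in the extended reals. -/
def supPhi (F G : PowerSeries ℂ_[p]) (D : Set ℂ_[p]) : EReal :=
  ⨆ x ∈ D, phi F G x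

end PadicSeries

end

/-! In terms of norms, one needs `c > 0` with `c ≤ max ‖F(x)‖ ‖G(x)‖` on `D`. On a closed disc of
radius `‖a‖` where both series converge, suppose both are arbitrarily small along a sequence.
`ℂ_[p]` is not locally compact, but a nonzero series is uniformly close to a polynomial with the
same dominant term, so its small values occur only near finitely many points
(`exists_finite_cover_of_norm_lt`). The sequence is then totally bounded, and a limit of a
subsequence is a common root (`exists_pos_le_max_of_forall_ne_zero`). The closed unit disc is such a
disc. In the open disc this leaves an annulus near the boundary. By finiteness it can be chosen so
that no radius in it has a valuation common to both sequences. At each of its points one of the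
series therefore has a unique term of maximal norm, and its value has that norm
(`norm_coeff_mul_pow_le_norm_eval`); a fixed nonzero term bounds it below. -/

open Filter Topology

namespace PadicSeries

/-- `A` is the maximum of the numbers `‖f i‖ * r ^ i`, and `N` is the last index where it is
attained. -/
structure IsDominant {K : Type*} [NormedField K] (f : ℕ → K) (r A : ℝ) (N : ℕ) : Prop where
  le : ∀ i, ‖f i‖ * r ^ i ≤ A
  eq : ‖f N‖ * r ^ N = A
  lt : ∀ i, N < i → ‖f i‖ * r ^ i < A

/-! ### Dominant terms and roots of polynomials -/

section Polynomials

variable {K : Type*} [NormedField K]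

lemma IsDominant.unique {f : ℕ → K} {r A B : ℝ} {M N : ℕ}
    (h : IsDominant f r A M) (h' : IsDominant f r B N) : A = B ∧ M = N := by
  have hAB : A = B := le_antisymm (h.eq ▸ h'.le M) (h'.eq ▸ h.le N)
  subst hAB
  refine ⟨rfl, le_antisymm ?_ ?_⟩
  · by_contra! hlt
    exact (h'.lt M hlt).ne h.eq
  · by_contra! hlt
    exact (h.lt N hlt).ne h'.eq

lemma IsDominant.const_mul {f : ℕ → K} {r A : ℝ} {N : ℕ} (h : IsDominant f r A N) {a : K}
    (ha : a ≠ 0) : IsDominant (fun i => a * f i) r (‖a‖ * A) N := by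
  have ha' : 0 < ‖a‖ := norm_pos_iff.2 ha
  refine ⟨fun i => ?_, ?_, fun i hi => ?_⟩
  · rw [norm_mul, mul_assoc]
    exact mul_le_mul_of_nonneg_left (h.le i) ha'.le
  · rw [norm_mul, mul_assoc, h.eq]
  · rw [norm_mul, mul_assoc]
    exact mul_lt_mul_of_pos_left (h.lt i hi) ha'

lemma norm_coeff_mul_X_sub_C_zero (g : Polynomial K) (ξ : K) (r : ℝ) :
    ‖(g * (Polynomial.X - Polynomial.C ξ)).coeff 0‖ * r ^ 0 = ‖g.coeff 0‖ * r ^ 0 * ‖ξ‖ := by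
  simp [Polynomial.mul_coeff_zero]

variable [IsUltrametricDist K]

lemma norm_sub_le_max' (x y : K) : ‖x - y‖ ≤ max ‖x‖ ‖y‖ := by
  rw [sub_eq_add_neg, ← norm_neg y]
  exact IsUltrametricDist.norm_add_le_max x (-y)

lemma norm_sub_eq_left_of_lt {x y : K} (h : ‖y‖ < ‖x‖) : ‖x - y‖ = ‖x‖ := by
  rw [sub_eq_add_neg, IsUltrametricDist.norm_add_eq_max_of_norm_ne_norm]
  · rw [norm_neg, max_eq_left h.le]
  · rw [norm_neg]; exact h.ne'

lemma norm_sub_eq_right_of_lt {x y : K} (h : ‖x‖ < ‖y‖) : ‖x - y‖ = ‖y‖ := by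
  rw [norm_sub_rev, norm_sub_eq_left_of_lt h]

lemma norm_coeff_mul_X_sub_C_succ_le (g : Polynomial K) (ξ : K) {r : ℝ} (hr : 0 < r) (i : ℕ) :
    ‖(g * (Polynomial.X - Polynomial.C ξ)).coeff (i + 1)‖ * r ^ (i + 1) ≤
      max (‖g.coeff i‖ * r ^ i * r) (‖g.coeff (i + 1)‖ * r ^ (i + 1) * ‖ξ‖) := by
  rw [Polynomial.coeff_mul_X_sub_C]
  calc _ ≤ max ‖g.coeff i‖ ‖g.coeff (i + 1) * ξ‖ * r ^ (i + 1) :=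
        mul_le_mul_of_nonneg_right (norm_sub_le_max' _ _) (by positivity)
    _ = _ := by
        rw [max_mul_of_nonneg _ _ (by positivity), norm_mul]
        congr 1 <;> ring

/-- In `g_N - g_{N+1} ξ` the first term wins strictly, even for `‖ξ‖ = r`, because `N` is the last
index attaining the maximum. -/
lemma IsDominant.mul_X_sub_C_of_le {g : Polynomial K} {r A : ℝ} {N : ℕ} (hr : 0 < r) (hA : 0 < A)
    (h : IsDominant g.coeff r A N) {ξ : K} (hξ : ‖ξ‖ ≤ r) :
    IsDominant (g * (Polynomial.X - Polynomial.C ξ)).coeff r (A * r) (N + 1) := by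
  have small : ∀ i, N < i → ‖g.coeff i‖ * r ^ i * ‖ξ‖ < A * r := fun i hi =>
    (mul_le_mul_of_nonneg_left hξ (by positivity)).trans_lt
      (mul_lt_mul_of_pos_right (h.lt i hi) hr)
  have hle : ∀ i, ‖g.coeff i‖ * r ^ i * ‖ξ‖ ≤ A * r := fun i =>
    mul_le_mul (h.le i) hξ (norm_nonneg _) hA.le
  refine ⟨fun i => ?_, ?_, fun i hi => ?_⟩
  · rcases i with _ | i
    · rw [norm_coeff_mul_X_sub_C_zero]
      exact hle 0
    · exact (norm_coeff_mul_X_sub_C_succ_le g ξ hr i).trans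
        (max_le (mul_le_mul_of_nonneg_right (h.le i) hr.le) (hle _))
  · rw [Polynomial.coeff_mul_X_sub_C, norm_sub_eq_left_of_lt, ← h.eq, pow_succ, mul_assoc]
    have h1 := small (N + 1) (Nat.lt_succ_self N)
    rw [← h.eq] at h1
    rw [norm_mul]
    have h2 : 0 < r ^ (N + 1) := by positivity
    refine lt_of_mul_lt_mul_right ?_ h2.le
    calc _ = ‖g.coeff (N + 1)‖ * r ^ (N + 1) * ‖ξ‖ := by ring
      _ < _ := h1
      _ = _ := by ring
  · rcases i with _ | i
    · omega
    · exact (norm_coeff_mul_X_sub_C_succ_le g ξ hr i).trans_lt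
        (max_lt (mul_lt_mul_of_pos_right (h.lt i (by omega)) hr) (small _ (by omega)))

/-- In `g_{N-1} - g_N ξ` the second term now wins, so a root outside the ball does not move the
dominant index. -/
lemma IsDominant.mul_X_sub_C_of_lt {g : Polynomial K} {r A : ℝ} {N : ℕ} (hr : 0 < r) (hA : 0 < A)
    (h : IsDominant g.coeff r A N) {ξ : K} (hξ : r < ‖ξ‖) :
    IsDominant (g * (Polynomial.X - Polynomial.C ξ)).coeff r (A * ‖ξ‖) N := by
  have hξ0 : 0 < ‖ξ‖ := hr.trans hξ
  have small : ∀ i, ‖g.coeff i‖ * r ^ i * r < A * ‖ξ‖ := fun i =>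
    (mul_le_mul_of_nonneg_right (h.le i) hr.le).trans_lt (mul_lt_mul_of_pos_left hξ hA)
  have hle : ∀ i, ‖g.coeff i‖ * r ^ i * ‖ξ‖ ≤ A * ‖ξ‖ := fun i =>
    mul_le_mul_of_nonneg_right (h.le i) hξ0.le
  refine ⟨fun i => ?_, ?_, fun i hi => ?_⟩
  · rcases i with _ | i
    · rw [norm_coeff_mul_X_sub_C_zero]
      exact hle 0
    · exact (norm_coeff_mul_X_sub_C_succ_le g ξ hr i).trans (max_le (small i).le (hle _))
  · rcases N with _ | N
    · rw [norm_coeff_mul_X_sub_C_zero, h.eq]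
    · rw [Polynomial.coeff_mul_X_sub_C, norm_sub_eq_right_of_lt, ← h.eq, norm_mul]
      · ring
      · have h1 := small N
        rw [← h.eq] at h1
        rw [norm_mul]
        have h2 : 0 < r ^ (N + 1) := by positivity
        refine lt_of_mul_lt_mul_right ?_ h2.le
        calc _ = ‖g.coeff N‖ * r ^ N * r := by ring
          _ < _ := h1
          _ = _ := by ring
  · rcases i with _ | i
    · omega
    · exact (norm_coeff_mul_X_sub_C_succ_le g ξ hr i).trans_lt
        (max_lt (small i) (mul_lt_mul_of_pos_right (h.lt _ hi) hξ0))

/-- A product of linear factors is dominated by the term whose index is the number of its roots in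
the closed ball, and it is large away from these roots. -/
lemma exists_isDominant_prod_X_sub_C {r : ℝ} (hr : 0 < r) (s : Multiset K) :
    ∃ A : ℝ, 0 < A ∧
      IsDominant ((s.map fun ξ => Polynomial.X - Polynomial.C ξ).prod).coeff r A
        (s.filter fun ξ => ‖ξ‖ ≤ r).card ∧
      ∀ δ, 0 < δ → ∀ x : K, ‖x‖ ≤ r → (∀ ξ ∈ s, ‖ξ‖ ≤ r → δ ≤ ‖x - ξ‖) →
        A * δ ^ (s.filter fun ξ => ‖ξ‖ ≤ r).card ≤
          ‖((s.map fun ξ => Polynomial.X - Polynomial.C ξ).prod).eval x‖ *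
            r ^ (s.filter fun ξ => ‖ξ‖ ≤ r).card := by
  induction s using Multiset.induction_on with
  | empty =>
    refine ⟨1, one_pos, ⟨fun i => ?_, by simp, fun i hi => ?_⟩, by simp⟩
    · rcases i with _ | i <;> simp [Polynomial.coeff_one]
    · rcases i with _ | i
      · simp at hi
      · simp [Polynomial.coeff_one]
  | cons ξ s ih =>
    obtain ⟨A, hA, hdom, hbound⟩ := ih
    rw [Multiset.map_cons, Multiset.prod_cons, mul_comm]
    by_cases hξ : ‖ξ‖ ≤ r
    · rw [Multiset.filter_cons_of_pos (p := fun ξ => ‖ξ‖ ≤ r) s hξ, Multiset.card_cons]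
      refine ⟨A * r, by positivity, hdom.mul_X_sub_C_of_le hr hA hξ, fun δ hδ x hx hfar => ?_⟩
      have h1 := hbound δ hδ x hx fun η hη => hfar η (Multiset.mem_cons_of_mem hη)
      have h2 := hfar ξ (Multiset.mem_cons_self ξ s) hξ
      rw [Polynomial.eval_mul, norm_mul, Polynomial.eval_sub, Polynomial.eval_X,
        Polynomial.eval_C, pow_succ, pow_succ]
      calc _ = A * δ ^ (s.filter fun ξ => ‖ξ‖ ≤ r).card * δ * r := by ring
        _ ≤ _ * ‖x - ξ‖ * r :=
          mul_le_mul_of_nonneg_right (mul_le_mul h1 h2 hδ.le (by positivity)) hr.le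
        _ = _ := by ring
    · have hξ' := not_le.1 hξ
      rw [Multiset.filter_cons_of_neg (p := fun ξ => ‖ξ‖ ≤ r) s hξ]
      refine ⟨A * ‖ξ‖, mul_pos hA (hr.trans hξ'), hdom.mul_X_sub_C_of_lt hr hA hξ',
        fun δ hδ x hx hfar => ?_⟩
      have h1 := hbound δ hδ x hx fun η hη => hfar η (Multiset.mem_cons_of_mem hη)
      rw [Polynomial.eval_mul, norm_mul, Polynomial.eval_sub, Polynomial.eval_X,
        Polynomial.eval_C, norm_sub_eq_right_of_lt (hx.trans_lt hξ')]
      calc _ = A * δ ^ (s.filter fun ξ => ‖ξ‖ ≤ r).card * ‖ξ‖ := by ring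
        _ ≤ _ * ‖ξ‖ := mul_le_mul_of_nonneg_right h1 (norm_nonneg _)
        _ = _ := by ring

variable [IsAlgClosed K]

/-- Split `g` into linear factors: uniqueness of the dominant term identifies `N` with the number of
roots in the ball. -/
lemma IsDominant.exists_roots {g : Polynomial K} {r A : ℝ} {N : ℕ} (hr : 0 < r) (hA : 0 < A)
    (h : IsDominant g.coeff r A N) :
    ∃ s : Multiset K, s.card = N ∧ (∀ ξ ∈ s, ‖ξ‖ ≤ r ∧ g.eval ξ = 0) ∧
      ∀ δ, 0 < δ → ∀ x : K, ‖x‖ ≤ r → (∀ ξ ∈ s, δ ≤ ‖x - ξ‖) →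
        A * δ ^ N ≤ ‖g.eval x‖ * r ^ N := by
  have hg : g ≠ 0 := by
    rintro rfl
    have := h.eq
    simp at this
    exact hA.ne this
  obtain ⟨s, hs⟩ := Polynomial.splits_iff_exists_multiset.1 (IsAlgClosed.splits g)
  have ha : g.leadingCoeff ≠ 0 := Polynomial.leadingCoeff_ne_zero.2 hg
  obtain ⟨B, hB, hdom, hbound⟩ := exists_isDominant_prod_X_sub_C hr s
  have hdom' := hdom.const_mul ha
  have hcoeff : (fun i => g.leadingCoeff *
      ((s.map fun ξ => Polynomial.X - Polynomial.C ξ).prod).coeff i) = g.coeff := by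
    funext i
    conv_rhs => rw [hs]
    rw [Polynomial.coeff_C_mul]
  rw [hcoeff] at hdom'
  obtain ⟨hAB, hN⟩ := h.unique hdom'
  refine ⟨s.filter fun ξ => ‖ξ‖ ≤ r, hN.symm, fun ξ hξ => ?_, fun δ hδ x hx hfar => ?_⟩
  · rw [Multiset.mem_filter] at hξ
    refine ⟨hξ.2, ?_⟩
    rw [hs, Polynomial.eval_mul, Polynomial.eval_multiset_prod, Multiset.map_map]
    refine mul_eq_zero_of_right _ (Multiset.prod_eq_zero ?_)
    exact Multiset.mem_map.2 ⟨ξ, hξ.1, by simp⟩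
  · have h1 := hbound δ hδ x hx fun ξ hξ hξr => hfar ξ (Multiset.mem_filter.2 ⟨hξ, hξr⟩)
    rw [← hN] at h1
    rw [hAB, hs, Polynomial.eval_mul, Polynomial.eval_C, norm_mul, mul_assoc, mul_assoc, ← hs]
    exact mul_le_mul_of_nonneg_left h1 (norm_nonneg _)

end Polynomials

/-! ### Maxima of real sequences tending to zero -/

section RealSequences

variable {u : ℕ → ℝ}

lemma exists_first_last_max (hu : Tendsto u atTop (𝓝 0)) {k : ℕ} (hk : 0 < u k) :
    ∃ m n : ℕ, m ≤ n ∧ 0 < u n ∧ u m = u n ∧ (∀ i, u i ≤ u n) ∧ (∀ i < m, u i < u n) ∧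
      ∀ i, n < i → u i < u n := by
  have hfin : {i | u k ≤ u i}.Finite := by
    have h := hu.eventually (gt_mem_nhds hk)
    rw [← Nat.cofinite_eq_atTop, eventually_cofinite] at h
    simpa using h
  obtain ⟨M, hM, hmax⟩ := Set.exists_max_image _ u hfin ⟨k, le_refl (u k)⟩
  have hall : ∀ i, u i ≤ u M := fun i => by
    rcases le_or_gt (u k) (u i) with h | h
    · exact hmax i h
    · exact h.le.trans hM
  have hfin' : {i | u i = u M}.Finite :=
    hfin.subset fun i (hi : u i = u M) => hM.trans_eq hi.symm
  obtain ⟨n, hn, hnmax⟩ := Set.exists_max_image _ id hfin' ⟨M, rfl⟩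
  obtain ⟨m, hm, hmmin⟩ := Set.exists_min_image _ id hfin' ⟨M, rfl⟩
  have hn' : u n = u M := hn
  have hm' : u m = u M := hm
  refine ⟨m, n, hnmax m hm, hn' ▸ hk.trans_le hM, hm'.trans hn'.symm, fun i => hn' ▸ hall i,
    fun i hi => ?_, fun i hi => ?_⟩
  · rw [hn']
    exact lt_of_le_of_ne (hall i) fun h => absurd (hmmin i h) (not_le.2 hi)
  · rw [hn']
    exact lt_of_le_of_ne (hall i) fun h => absurd (hnmax i h) (not_le.2 hi)

/-- A uniform gap is needed because an infinite ultrametric sum inherits only non-strict bounds from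
its terms. -/
lemma exists_lt_forall_le (hu : Tendsto u atTop (𝓝 0)) {A : ℝ} (hA : 0 < A) (h : ∀ i, u i < A) :
    ∃ C, 0 ≤ C ∧ C < A ∧ ∀ i, u i ≤ C := by
  by_cases hpos : ∃ k, 0 < u k
  · obtain ⟨k, hk⟩ := hpos
    obtain ⟨_, n, -, hn, -, hall, -, -⟩ := exists_first_last_max hu hk
    exact ⟨u n, hn.le, h n, hall⟩
  · push Not at hpos
    exact ⟨0, le_rfl, hA, hpos⟩

end RealSequences

/-! ### Power series on closed balls -/

section Series

variable {K : Type*} [NormedField K]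

lemma norm_mul_pow_le_of_norm_le (a : K) {x : K} {r : ℝ} (hx : ‖x‖ ≤ r) (i : ℕ) :
    ‖a * x ^ i‖ ≤ ‖a‖ * r ^ i := by
  rw [norm_mul, norm_pow]
  gcongr

lemma tendsto_term {f : ℕ → K} {r : ℝ} (hf : Tendsto (fun i => ‖f i‖ * r ^ i) atTop (𝓝 0)) {x : K}
    (hx : ‖x‖ ≤ r) : Tendsto (fun i => f i * x ^ i) atTop (𝓝 0) :=
  squeeze_zero_norm (fun i => norm_mul_pow_le_of_norm_le _ hx i) hf

lemma exists_isDominant {f : ℕ → K} {r : ℝ} (hr : 0 < r)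
    (hf : Tendsto (fun i => ‖f i‖ * r ^ i) atTop (𝓝 0)) {k : ℕ} (hk : f k ≠ 0) :
    ∃ A N, 0 < A ∧ IsDominant f r A N := by
  have hk' : 0 < ‖f k‖ * r ^ k := mul_pos (norm_pos_iff.2 hk) (by positivity)
  obtain ⟨_, n, -, hn, -, hall, -, hlt⟩ := exists_first_last_max hf hk'
  exact ⟨_, n, hn, hall, rfl, hlt⟩

variable [IsUltrametricDist K]

/-- Carries the dominant term of a series over to its polynomial approximations. -/
lemma IsDominant.of_norm_sub_lt {f g : ℕ → K} {r A ε : ℝ} {N : ℕ} (hr : 0 < r) (hε : ε < A)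
    (h : IsDominant f r A N) (hfg : ∀ i, ‖f i - g i‖ * r ^ i ≤ ε) : IsDominant g r A N := by
  have key : ∀ i, ‖g i‖ * r ^ i ≤ max (‖f i‖ * r ^ i) (‖f i - g i‖ * r ^ i) := fun i => by
    rw [← max_mul_of_nonneg _ _ (by positivity)]
    refine mul_le_mul_of_nonneg_right ?_ (by positivity)
    simpa using norm_sub_le_max' (f i) (f i - g i)
  refine ⟨fun i => (key i).trans (max_le (h.le i) ((hfg i).trans hε.le)), ?_,
    fun i hi => (key i).trans_lt (max_lt (h.lt i hi) ((hfg i).trans_lt hε))⟩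
  have hlt : ‖f N - g N‖ < ‖f N‖ := by
    have h2 : 0 < r ^ N := by positivity
    refine lt_of_mul_lt_mul_right ?_ h2.le
    rw [h.eq]
    exact (hfg N).trans_lt hε
  have := norm_sub_eq_left_of_lt hlt
  rw [sub_sub_cancel] at this
  rw [this, h.eq]

variable [CompleteSpace K]

lemma summable_of_tendsto_zero {v : ℕ → K} (hv : Tendsto v atTop (𝓝 0)) : Summable v :=
  NonarchimedeanAddGroup.summable_of_tendsto_cofinite_zero (by rwa [Nat.cofinite_eq_atTop])

lemma norm_tsum_eq_of_forall_lt {v : ℕ → K} (hv : Tendsto v atTop (𝓝 0)) {N : ℕ} (hN : v N ≠ 0)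
    (h : ∀ i, i ≠ N → ‖v i‖ < ‖v N‖) : ‖∑' i, v i‖ = ‖v N‖ := by
  have hpos := norm_pos_iff.2 hN
  have hw : Tendsto (Function.update v N 0) atTop (𝓝 0) := by
    refine hv.congr' ?_
    filter_upwards [eventually_gt_atTop N] with i hi
    rw [Function.update_of_ne hi.ne']
  obtain ⟨C, hC0, hC, hle⟩ := exists_lt_forall_le (u := fun i => ‖Function.update v N 0 i‖)
    (by simpa using hw.norm) hpos (fun i => by
      by_cases hi : i = N
      · subst hi; simpa using hN
      · simpa [hi] using h i hi)
  have hsum : ∑' i, v i = v N - -∑' i, Function.update v N 0 i := by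
    have h1 := (summable_of_tendsto_zero hv).hasSum.update N 0
    rw [h1.tsum_eq]
    abel
  rw [hsum]
  refine norm_sub_eq_left_of_lt ?_
  rw [norm_neg]
  exact (IsUltrametricDist.norm_tsum_le_of_forall_le_of_nonneg hC0 hle).trans_lt hC

variable {F G : PowerSeries K} {r : ℝ}

lemma exists_polynomial_approx
    (hF : Tendsto (fun i => ‖PowerSeries.coeff i F‖ * r ^ i) atTop (𝓝 0)) {ε : ℝ} (hε : 0 < ε) :
    ∃ g : Polynomial K, (∀ i, ‖PowerSeries.coeff i F - g.coeff i‖ * r ^ i ≤ ε) ∧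
      ∀ x : K, ‖x‖ ≤ r → ‖∑' i, PowerSeries.coeff i F * x ^ i - g.eval x‖ ≤ ε := by
  obtain ⟨n, hn⟩ := eventually_atTop.1 (hF.eventually (gt_mem_nhds hε))
  have hcoeff : ∀ i, ‖PowerSeries.coeff i F - (PowerSeries.trunc n F).coeff i‖ * r ^ i ≤ ε := by
    intro i
    rw [PowerSeries.coeff_trunc]
    split_ifs with hi
    · simpa using hε.le
    · simpa using (hn i (not_lt.1 hi)).le
  refine ⟨PowerSeries.trunc n F, hcoeff, fun x hx => ?_⟩
  have hg : HasSum (fun i => (PowerSeries.trunc n F).coeff i * x ^ i)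
      ((PowerSeries.trunc n F).eval x) := by
    rw [Polynomial.eval_eq_sum, Polynomial.sum]
    refine hasSum_sum_of_ne_finset_zero fun i hi => ?_
    rw [Polynomial.notMem_support_iff.1 hi, zero_mul]
  have hsum := ((summable_of_tendsto_zero (tendsto_term hF hx)).hasSum.sub hg).tsum_eq
  rw [← hsum]
  refine IsUltrametricDist.norm_tsum_le_of_forall_le_of_nonneg hε.le fun i => ?_
  rw [← sub_mul]
  exact (norm_mul_pow_le_of_norm_le _ hx i).trans (hcoeff i)

lemma continuousOn_tsum_powerSeries
    (hF : Tendsto (fun i => ‖PowerSeries.coeff i F‖ * r ^ i) atTop (𝓝 0)) :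
    ContinuousOn (fun x : K => ∑' i, PowerSeries.coeff i F * x ^ i) (Metric.closedBall 0 r) := by
  refine continuousOn_of_uniform_approx_of_continuousOn fun U hU => ?_
  obtain ⟨ε, hε, hεU⟩ := Metric.mem_uniformity_dist.1 hU
  obtain ⟨g, -, hg⟩ := exists_polynomial_approx hF (half_pos hε)
  refine ⟨fun x => g.eval x, g.continuous.continuousOn, fun x hx => hεU ?_⟩
  rw [dist_eq_norm]
  exact (hg x (mem_closedBall_zero_iff.1 hx)).trans_lt (half_lt_self hε)

lemma tsum_eq_zero_of_tendsto
    (hF : Tendsto (fun i => ‖PowerSeries.coeff i F‖ * r ^ i) atTop (𝓝 0)) {x : ℕ → K}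
    (hx : ∀ j, ‖x j‖ ≤ r) {y : K} (hy : ‖y‖ ≤ r) (hxy : Tendsto x atTop (𝓝 y))
    (hlim : Tendsto (fun j => ∑' i, PowerSeries.coeff i F * x j ^ i) atTop (𝓝 0)) :
    ∑' i, PowerSeries.coeff i F * y ^ i = 0 := by
  have hc := continuousOn_tsum_powerSeries hF y (mem_closedBall_zero_iff.2 hy)
  have hx' : Tendsto x atTop (𝓝[Metric.closedBall 0 r] y) :=
    tendsto_nhdsWithin_iff.2
      ⟨hxy, Eventually.of_forall fun j => mem_closedBall_zero_iff.2 (hx j)⟩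
  exact tendsto_nhds_unique (hc.tendsto.comp hx') hlim

variable [IsAlgClosed K]

/-- The points of a closed ball at which a power series is small can be covered by finitely many
balls of a given radius. -/
lemma exists_finite_cover_of_norm_lt (hr : 0 < r) (hF0 : F ≠ 0)
    (hF : Tendsto (fun i => ‖PowerSeries.coeff i F‖ * r ^ i) atTop (𝓝 0)) {δ : ℝ} (hδ : 0 < δ) :
    ∃ ε > 0, ∃ t : Set K, t.Finite ∧
      ∀ x : K, ‖x‖ ≤ r → ‖∑' i, PowerSeries.coeff i F * x ^ i‖ < ε → ∃ ξ ∈ t, dist x ξ < δ := by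
  obtain ⟨A, N, hA, hdom⟩ := exists_isDominant (f := fun i => PowerSeries.coeff i F) hr hF
    (PowerSeries.coeff_order hF0)
  -- The first bound preserves the dominant term; the second lies below the size of `g` at distance
  -- at least `δ` from its roots in the ball.
  have hε : 0 < min (A / 2) (A * δ ^ N / r ^ N / 2) := by positivity
  obtain ⟨g, hcoeff, hg⟩ := exists_polynomial_approx hF hε
  have hεA : min (A / 2) (A * δ ^ N / r ^ N / 2) < A :=
    (min_le_left _ _).trans_lt (half_lt_self hA)
  obtain ⟨s, -, -, hfar⟩ := (hdom.of_norm_sub_lt hr hεA hcoeff).exists_roots hr hA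
  classical
  refine ⟨_, hε, ↑s.toFinset, s.toFinset.finite_toSet, fun x hx hxε => ?_⟩
  by_contra! hno
  have h1 := hfar δ hδ x hx fun ξ hξ => by
    rw [← dist_eq_norm]
    exact hno ξ (by simpa using hξ)
  have h2 : ‖g.eval x‖ ≤ min (A / 2) (A * δ ^ N / r ^ N / 2) := by
    have := norm_sub_le_max' (∑' i, PowerSeries.coeff i F * x ^ i)
      (∑' i, PowerSeries.coeff i F * x ^ i - g.eval x)
    rw [sub_sub_cancel] at this
    exact this.trans (max_le hxε.le (hg x hx))
  have h3 : A * δ ^ N / r ^ N ≤ ‖g.eval x‖ := by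
    rwa [div_le_iff₀ (by positivity)]
  have h4 : 0 < A * δ ^ N / r ^ N := by positivity
  linarith [h2.trans (min_le_right _ _)]

/-- The finite covers catch all but finitely many points of the sequence, so its range is totally
bounded; completeness makes the closure compact. -/
lemma exists_subseq_tendsto (hr : 0 < r) (hF0 : F ≠ 0)
    (hF : Tendsto (fun i => ‖PowerSeries.coeff i F‖ * r ^ i) atTop (𝓝 0)) {x : ℕ → K}
    (hx : ∀ j, ‖x j‖ ≤ r)
    (hlim : Tendsto (fun j => ∑' i, PowerSeries.coeff i F * x j ^ i) atTop (𝓝 0)) :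
    ∃ y : K, ‖y‖ ≤ r ∧ ∃ φ : ℕ → ℕ, StrictMono φ ∧ Tendsto (x ∘ φ) atTop (𝓝 y) := by
  have htb : TotallyBounded (Set.range x) := by
    rw [Metric.totallyBounded_iff]
    intro δ hδ
    obtain ⟨ε, hε, t, ht, hcov⟩ := exists_finite_cover_of_norm_lt hr hF0 hF hδ
    obtain ⟨n, hn⟩ := eventually_atTop.1
      ((tendsto_zero_iff_norm_tendsto_zero.1 hlim).eventually (gt_mem_nhds hε))
    refine ⟨t ∪ x '' Set.Iio n, ht.union ((Set.finite_Iio n).image x), ?_⟩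
    rintro _ ⟨j, rfl⟩
    rw [Set.mem_iUnion₂]
    rcases lt_or_ge j n with hj | hj
    · exact ⟨x j, Or.inr ⟨j, hj, rfl⟩, Metric.mem_ball_self hδ⟩
    · obtain ⟨ξ, hξ, hd⟩ := hcov (x j) (hx j) (hn j hj)
      exact ⟨ξ, Or.inl hξ, hd⟩
  have hcomp : IsCompact (closure (Set.range x)) :=
    htb.closure.isCompact_of_isClosed isClosed_closure
  obtain ⟨y, -, φ, hφ, hy⟩ := hcomp.tendsto_subseq fun j => subset_closure (Set.mem_range_self j)
  exact ⟨y, le_of_tendsto hy.norm (Eventually.of_forall fun j => hx (φ j)), φ, hφ, hy⟩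

/-- Two power series without common root in a closed ball on which they converge cannot both
become arbitrarily small on it. -/
lemma exists_pos_le_max_of_forall_ne_zero (hr : 0 < r) (hF0 : F ≠ 0)
    (hF : Tendsto (fun i => ‖PowerSeries.coeff i F‖ * r ^ i) atTop (𝓝 0))
    (hG : Tendsto (fun i => ‖PowerSeries.coeff i G‖ * r ^ i) atTop (𝓝 0))
    (hroot : ∀ x : K, ‖x‖ ≤ r → ¬ (∑' i, PowerSeries.coeff i F * x ^ i = 0 ∧
      ∑' i, PowerSeries.coeff i G * x ^ i = 0)) :
    ∃ c > 0, ∀ x : K, ‖x‖ ≤ r → c ≤ max ‖∑' i, PowerSeries.coeff i F * x ^ i‖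
      ‖∑' i, PowerSeries.coeff i G * x ^ i‖ := by
  by_contra! hno
  choose x hx hlt using fun j : ℕ => hno (1 / ((j : ℝ) + 1)) (by positivity)
  have hlimF : Tendsto (fun j => ∑' i, PowerSeries.coeff i F * x j ^ i) atTop (𝓝 0) :=
    squeeze_zero_norm (fun j => ((le_max_left _ _).trans_lt (hlt j)).le)
      tendsto_one_div_add_atTop_nhds_zero_nat
  have hlimG : Tendsto (fun j => ∑' i, PowerSeries.coeff i G * x j ^ i) atTop (𝓝 0) :=
    squeeze_zero_norm (fun j => ((le_max_right _ _).trans_lt (hlt j)).le)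
      tendsto_one_div_add_atTop_nhds_zero_nat
  obtain ⟨y, hy, φ, hφ, hxy⟩ := exists_subseq_tendsto hr hF0 hF hx hlimF
  exact hroot y hy
    ⟨tsum_eq_zero_of_tendsto hF (fun j => hx (φ j)) hy hxy (hlimF.comp hφ.tendsto_atTop),
      tsum_eq_zero_of_tendsto hG (fun j => hx (φ j)) hy hxy (hlimG.comp hφ.tendsto_atTop)⟩

/-- A power series without roots in a closed ball has constant norm on it. -/
lemma norm_tsum_eq_of_forall_ne_zero (hr : 0 < r)
    (hF : Tendsto (fun i => ‖PowerSeries.coeff i F‖ * r ^ i) atTop (𝓝 0))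
    (hroot : ∀ x : K, ‖x‖ ≤ r → ∑' i, PowerSeries.coeff i F * x ^ i ≠ 0) {x : K} (hx : ‖x‖ ≤ r) :
    ‖∑' i, PowerSeries.coeff i F * x ^ i‖ = ‖PowerSeries.coeff 0 F‖ := by
  have hF0 : F ≠ 0 := by
    rintro rfl
    exact hroot x hx (by simp)
  obtain ⟨A, N, hA, hdom⟩ := exists_isDominant (f := fun i => PowerSeries.coeff i F) hr hF
    (PowerSeries.coeff_order hF0)
  -- Pairing `F` with itself bounds `‖F(x)‖` below by `c`. A root in the ball of a `c / 2`-close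
  -- polynomial would violate this, which forces `N = 0`.
  obtain ⟨c, hc, hcle⟩ := exists_pos_le_max_of_forall_ne_zero hr hF0 hF hF
    fun x hx h => hroot x hx h.1
  simp only [max_self] at hcle
  have hε : 0 < min (A / 2) (c / 2) := by positivity
  obtain ⟨g, hcoeff, hg⟩ := exists_polynomial_approx hF hε
  obtain ⟨s, hcard, hs, -⟩ := (hdom.of_norm_sub_lt hr
    ((min_le_left _ _).trans_lt (half_lt_self hA)) hcoeff).exists_roots hr hA
  have hs0 : s = 0 := by
    refine Multiset.eq_zero_of_forall_notMem fun ξ hξ => ?_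
    have h1 := hg ξ (hs ξ hξ).1
    rw [(hs ξ hξ).2, sub_zero] at h1
    linarith [hcle ξ (hs ξ hξ).1, min_le_right (A / 2) (c / 2)]
  obtain rfl : N = 0 := by rw [← hcard, hs0, Multiset.card_zero]
  have hA' : ‖PowerSeries.coeff 0 F‖ = A := by simpa using hdom.eq
  have h0 : PowerSeries.coeff 0 F * x ^ 0 ≠ 0 := by
    rw [pow_zero, mul_one, ← norm_pos_iff, hA']
    exact hA
  rw [norm_tsum_eq_of_forall_lt (tendsto_term hF hx) h0]
  · rw [pow_zero, mul_one]
  · intro i hi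
    rw [pow_zero, mul_one, hA']
    exact (norm_mul_pow_le_of_norm_le _ hx i).trans_lt (hdom.lt i (Nat.pos_of_ne_zero hi))

end Series

variable {p : ℕ} [Fact p.Prime]

/-! ### Characteristic sequence and Newton polygon slopes -/

section Slopes

variable {F : PowerSeries ℂ_[p]}

lemma one_lt_natCast_prime (p : ℕ) [Fact p.Prime] : (1 : ℝ) < p := by
  exact_mod_cast (Fact.out : p.Prime).one_lt

lemma vp_of_ne_zero {x : ℂ_[p]} (hx : x ≠ 0) : vp x = ((-Real.logb p ‖x‖ : ℝ) : EReal) := by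
  rw [vp, if_neg hx]

lemma vp_le_of_le_norm {x : ℂ_[p]} {c : ℝ} (hc : 0 < c) (hx : c ≤ ‖x‖) :
    vp x ≤ ((-Real.logb p c : ℝ) : EReal) := by
  rw [vp_of_ne_zero (norm_pos_iff.1 (hc.trans_le hx)), EReal.coe_le_coe_iff, neg_le_neg_iff]
  exact Real.logb_le_logb_of_le (one_lt_natCast_prime p) hc hx

lemma rootSlope_of_ne_zero {k n : ℕ} (hk : PowerSeries.coeff k F ≠ 0)
    (hn : PowerSeries.coeff n F ≠ 0) :
    rootSlope F k n = (((Real.logb p ‖PowerSeries.coeff n F‖ -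
      Real.logb p ‖PowerSeries.coeff k F‖) / ((n : ℝ) - k) : ℝ) : EReal) := by
  rw [rootSlope, vp_of_ne_zero hk, vp_of_ne_zero hn, ← EReal.coe_sub, ← EReal.coe_div]
  congr 2
  ring

lemma rootSlope_of_eq_zero {k n : ℕ} (hkn : k < n) (hk : PowerSeries.coeff k F ≠ 0)
    (hn : PowerSeries.coeff n F = 0) : rootSlope F k n = ⊥ := by
  have hpos : (0 : ℝ) < (n : ℝ) - k := sub_pos.2 (by exact_mod_cast hkn)
  rw [rootSlope, vp_of_ne_zero hk, hn, vp, if_pos rfl, EReal.sub_top]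
  exact EReal.bot_div_of_pos_ne_top (by exact_mod_cast hpos) (EReal.coe_ne_top _)

lemma nextIndex_eq_some {k n : ℕ} (h : IsGreatest (maximizers F k) n) :
    nextIndex F k = some n := by
  have hex : ∃ n, IsGreatest (maximizers F k) n := ⟨n, h⟩
  rw [nextIndex, dif_pos hex, hex.choose_spec.unique h]

/-- If `m` is the first index where `log ‖F_j‖ - j s` is maximal, then the characteristic sequence
does not jump over `m`. -/
lemma exists_nextIndex_le {s : ℝ} {k m : ℕ} (hkm : k < m) (hk : PowerSeries.coeff k F ≠ 0)
    (hm : PowerSeries.coeff m F ≠ 0)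
    (hlt : Real.logb p ‖PowerSeries.coeff k F‖ - k * s <
      Real.logb p ‖PowerSeries.coeff m F‖ - m * s)
    (hle : ∀ j, PowerSeries.coeff j F ≠ 0 → Real.logb p ‖PowerSeries.coeff j F‖ - j * s ≤
      Real.logb p ‖PowerSeries.coeff m F‖ - m * s) :
    ∃ k', nextIndex F k = some k' ∧ k < k' ∧ k' ≤ m ∧ PowerSeries.coeff k' F ≠ 0 := by
  have hkm' : (0 : ℝ) < (m : ℝ) - k := sub_pos.2 (by exact_mod_cast hkm)
  -- For the points `(j, log ‖F_j‖)`, the chord from `k` to `m` has slope above `s` and chords from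
  -- `m` to later points have slope at most `s`. Hence every maximizer is at most `m`.
  have hbeyond : ∀ j, m < j → rootSlope F k j < rootSlope F k m := fun j hj => by
    by_cases hj0 : PowerSeries.coeff j F = 0
    · rw [rootSlope_of_eq_zero (hkm.trans hj) hk hj0, rootSlope_of_ne_zero hk hm]
      exact EReal.bot_lt_coe _
    · have hmj : (0 : ℝ) < (j : ℝ) - m := sub_pos.2 (by exact_mod_cast hj)
      rw [rootSlope_of_ne_zero hk hj0, rootSlope_of_ne_zero hk hm, EReal.coe_lt_coe_iff,
        div_lt_div_iff₀ (by linarith) hkm']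
      have h1 := hle j hj0
      nlinarith [mul_le_mul_of_nonneg_right h1 hkm'.le, mul_lt_mul_of_pos_right hlt hmj]
  obtain ⟨M, hM, hmax⟩ := Set.exists_max_image (Set.Ioc k m) (rootSlope F k) (Set.finite_Ioc k m)
    ⟨m, hkm, le_rfl⟩
  have hMmem : M ∈ maximizers F k := ⟨hM.1, fun j hj => by
    rcases le_or_gt j m with h | h
    · exact hmax j ⟨hj, h⟩
    · exact (hbeyond j h).le.trans (hmax m ⟨hkm, le_rfl⟩)⟩
  have hbdd : ∀ j ∈ maximizers F k, j ≤ m := fun j hj => by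
    by_contra! h
    exact absurd (hj.2 m hkm) (not_le.2 (hbeyond j h))
  obtain ⟨k', hk', hgreat⟩ := Set.exists_max_image (maximizers F k) id
    ((Set.finite_Iic m).subset hbdd) ⟨M, hMmem⟩
  refine ⟨k', nextIndex_eq_some ⟨hk', hgreat⟩, hk'.1, hbdd k' hk', fun h0 => ?_⟩
  have h := hk'.2 m hkm
  rw [rootSlope_of_eq_zero hk'.1 hk h0, rootSlope_of_ne_zero hk hm] at h
  exact absurd h (not_le.2 (EReal.bot_lt_coe _))

/-- The sequence starts at or below `m`, increases strictly and cannot jump over `m`, so it hits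
`m`. -/
lemma exists_charSeq_eq_some {s : ℝ} {m : ℕ} (hm : PowerSeries.coeff m F ≠ 0)
    (hlt : ∀ j < m, PowerSeries.coeff j F ≠ 0 → Real.logb p ‖PowerSeries.coeff j F‖ - j * s <
      Real.logb p ‖PowerSeries.coeff m F‖ - m * s)
    (hle : ∀ j, PowerSeries.coeff j F ≠ 0 → Real.logb p ‖PowerSeries.coeff j F‖ - j * s ≤
      Real.logb p ‖PowerSeries.coeff m F‖ - m * s) :
    ∃ i, charSeq F i = some m := by
  have key : ∀ d k i, charSeq F i = some k → PowerSeries.coeff k F ≠ 0 → k ≤ m → m - k ≤ d →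
      ∃ i, charSeq F i = some m := by
    intro d
    induction d with
    | zero =>
      intro k i hi _ hkm hd
      obtain rfl : k = m := by omega
      exact ⟨i, hi⟩
    | succ d ih =>
      intro k i hi hk hkm hd
      rcases hkm.eq_or_lt with rfl | hkm
      · exact ⟨i, hi⟩
      · obtain ⟨k', hnext, hkk', hk'm, hk'⟩ := exists_nextIndex_le hkm hk hm (hlt k hkm hk) hle
        exact ih k' (i + 1) (by rw [charSeq, hi, Option.bind_some, hnext]) hk' hk'm (by omega)
  have hF : F ≠ 0 := by
    rintro rfl
    simp at hm
  refine key _ F.order.toNat 0 rfl (PowerSeries.coeff_order hF) ?_ le_rfl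
  by_contra! h
  exact hm (PowerSeries.coeff_of_lt_order_toNat m h)

lemma logb_norm_mul_pow {a : ℂ_[p]} (ha : a ≠ 0) {r : ℝ} (hr : 0 < r) (i : ℕ) :
    Real.logb p (‖a‖ * r ^ i) = Real.logb p ‖a‖ - i * -Real.logb p r := by
  rw [Real.logb_mul (norm_ne_zero_iff.2 ha) (by positivity), Real.logb_pow]
  ring

/-- If the maximum of `‖F_i‖ r ^ i` is attained more than once, then `-log r` is one of the terms
of the valuation sequence. -/
lemma neg_logb_mem_rootValuations {r : ℝ} (hr : 0 < r) {m n : ℕ} (hmn : m < n)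
    (hpos : 0 < ‖PowerSeries.coeff n F‖ * r ^ n)
    (heq : ‖PowerSeries.coeff m F‖ * r ^ m = ‖PowerSeries.coeff n F‖ * r ^ n)
    (hle : ∀ i, ‖PowerSeries.coeff i F‖ * r ^ i ≤ ‖PowerSeries.coeff n F‖ * r ^ n)
    (hfirst : ∀ i < m, ‖PowerSeries.coeff i F‖ * r ^ i < ‖PowerSeries.coeff n F‖ * r ^ n)
    (hlast : ∀ i, n < i → ‖PowerSeries.coeff i F‖ * r ^ i < ‖PowerSeries.coeff n F‖ * r ^ n) :
    ((-Real.logb p r : ℝ) : EReal) ∈ rootValuations F := by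
  have hp := one_lt_natCast_prime p
  have hn0 : PowerSeries.coeff n F ≠ 0 := fun h => by simp [h] at hpos
  have hm0 : PowerSeries.coeff m F ≠ 0 := fun h => by
    rw [← heq] at hpos
    simp [h] at hpos
  set s := -Real.logb p r with hs
  have heq' : Real.logb p ‖PowerSeries.coeff m F‖ - m * s =
      Real.logb p ‖PowerSeries.coeff n F‖ - n * s := by
    rw [hs, ← logb_norm_mul_pow hm0 hr, ← logb_norm_mul_pow hn0 hr, heq]
  have hle' : ∀ j, PowerSeries.coeff j F ≠ 0 → Real.logb p ‖PowerSeries.coeff j F‖ - j * s ≤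
      Real.logb p ‖PowerSeries.coeff m F‖ - m * s := fun j hj => by
    rw [heq', hs, ← logb_norm_mul_pow hj hr, ← logb_norm_mul_pow hn0 hr]
    exact Real.logb_le_logb_of_le hp (mul_pos (norm_pos_iff.2 hj) (by positivity)) (hle j)
  have hlt' : ∀ j, PowerSeries.coeff j F ≠ 0 →
      ‖PowerSeries.coeff j F‖ * r ^ j < ‖PowerSeries.coeff n F‖ * r ^ n →
      Real.logb p ‖PowerSeries.coeff j F‖ - j * s <
      Real.logb p ‖PowerSeries.coeff m F‖ - m * s := fun j hj h => by
    rw [heq', hs, ← logb_norm_mul_pow hj hr, ← logb_norm_mul_pow hn0 hr]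
    exact Real.logb_lt_logb hp (mul_pos (norm_pos_iff.2 hj) (by positivity)) h
  obtain ⟨i, hi⟩ := exists_charSeq_eq_some hm0 (fun j hj hj0 => hlt' j hj0 (hfirst j hj)) hle'
  have hslope : rootSlope F m n = (s : EReal) := by
    have hmn' : (0 : ℝ) < (n : ℝ) - m := sub_pos.2 (by exact_mod_cast hmn)
    rw [rootSlope_of_ne_zero hm0 hn0, EReal.coe_eq_coe_iff, div_eq_iff hmn'.ne']
    linarith
  -- No chord from `m` to a later point is steeper than `s`, and those ending beyond `n` are
  -- strictly flatter.
  have hnext : nextIndex F m = some n := by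
    refine nextIndex_eq_some ⟨⟨hmn, fun j hj => ?_⟩, fun j hj => ?_⟩
    · rw [hslope]
      by_cases hj0 : PowerSeries.coeff j F = 0
      · rw [rootSlope_of_eq_zero hj hm0 hj0]
        exact bot_le
      · have hmj : (0 : ℝ) < (j : ℝ) - m := sub_pos.2 (by exact_mod_cast hj)
        rw [rootSlope_of_ne_zero hm0 hj0, EReal.coe_le_coe_iff, div_le_iff₀ hmj]
        linarith [hle' j hj0]
    · by_contra! hnj
      have h := hj.2 n hmn
      rw [hslope] at h
      by_cases hj0 : PowerSeries.coeff j F = 0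
      · rw [rootSlope_of_eq_zero hj.1 hm0 hj0] at h
        exact absurd h (not_le.2 (EReal.bot_lt_coe _))
      · have hmj : (0 : ℝ) < (j : ℝ) - m := sub_pos.2 (by exact_mod_cast hj.1)
        rw [rootSlope_of_ne_zero hm0 hj0, EReal.coe_le_coe_iff, le_div_iff₀ hmj] at h
        linarith [hlt' j hj0 (hlast j hnj)]
  exact ⟨i, m, n, hi, by rw [charSeq, hi, Option.bind_some, hnext], hslope.symm⟩

/-- At a point whose valuation is not a term of the valuation sequence, the value of the series has
the largest norm allowed by the ultrametric inequality. -/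
lemma norm_coeff_mul_pow_le_norm_eval {x : ℂ_[p]} (hx : x ≠ 0)
    (hF : Tendsto (fun i => ‖PowerSeries.coeff i F‖ * ‖x‖ ^ i) atTop (𝓝 0))
    (hmem : ((-Real.logb p ‖x‖ : ℝ) : EReal) ∉ rootValuations F) (k : ℕ) :
    ‖PowerSeries.coeff k F‖ * ‖x‖ ^ k ≤ ‖eval F x‖ := by
  have hx' : 0 < ‖x‖ := norm_pos_iff.2 hx
  by_cases hk : PowerSeries.coeff k F = 0
  · rw [hk, norm_zero, zero_mul]
    exact norm_nonneg _
  obtain ⟨m, n, hmn, hpos, heq, hle, hfirst, hlast⟩ := exists_first_last_max hF (k := k)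
    (mul_pos (norm_pos_iff.2 hk) (by positivity))
  -- If the first and last maximal indices differ, the valuation of `x` is a slope; otherwise a
  -- single term dominates the sum strictly.
  rcases hmn.lt_or_eq with hmn | rfl
  · exact absurd (neg_logb_mem_rootValuations hx' hmn hpos heq hle hfirst hlast) hmem
  · have hnorm : ∀ i, ‖PowerSeries.coeff i F * x ^ i‖ = ‖PowerSeries.coeff i F‖ * ‖x‖ ^ i :=
      fun i => by rw [norm_mul, norm_pow]
    have h0 : PowerSeries.coeff m F * x ^ m ≠ 0 := by
      rw [← norm_pos_iff, hnorm]
      exact hpos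
    rw [eval, norm_tsum_eq_of_forall_lt (tendsto_term hF le_rfl) h0, hnorm]
    · exact hle k
    · intro i hi
      rw [hnorm, hnorm]
      rcases hi.lt_or_gt with h | h
      · exact hfirst i h
      · exact hlast i h

end Slopes

/-! ### Lower bounds on the unit discs -/

section Discs

variable {F G : PowerSeries ℂ_[p]}

/-- An `n`-th root of `p` has norm `p^(-1/n)`, which tends to 1. Such points supply radii at which
convergence is known. -/
lemma exists_lt_norm_lt_one {t : ℝ} (ht : t < 1) : ∃ a : ℂ_[p], t < ‖a‖ ∧ ‖a‖ < 1 := by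
  have hp : (0 : ℝ) < (p : ℝ)⁻¹ := inv_pos.2 (zero_lt_one.trans (one_lt_natCast_prime p))
  have hnorm : ‖(p : ℂ_[p])‖ = (p : ℝ)⁻¹ := by
    have h := PadicComplex.norm_extends' p (p : ℚ_[p])
    rwa [Padic.norm_p, map_natCast, PadicComplex.coe_natCast] at h
  have ht1 : max t 0 < 1 := max_lt ht one_pos
  obtain ⟨n, hn⟩ := exists_pow_lt_of_lt_one hp ht1
  have hn0 : n ≠ 0 := by
    rintro rfl
    have := inv_lt_one_of_one_lt₀ (one_lt_natCast_prime p)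
    rw [pow_zero] at hn
    linarith
  obtain ⟨z, hz⟩ := IsAlgClosed.exists_pow_nat_eq (p : ℂ_[p]) (Nat.pos_of_ne_zero hn0)
  have hz' : ‖z‖ ^ n = (p : ℝ)⁻¹ := by rw [← norm_pow, hz, hnorm]
  refine ⟨z, (le_max_left t 0).trans_lt (lt_of_pow_lt_pow_left₀ n (norm_nonneg z) (hz' ▸ hn)), ?_⟩
  refine lt_of_pow_lt_pow_left₀ n zero_le_one ?_
  rw [hz', one_pow]
  exact inv_lt_one_of_one_lt₀ (one_lt_natCast_prime p)

lemma ConvergesOn.tendsto {D : Set ℂ_[p]} (hF : ConvergesOn F D) {a : ℂ_[p]} (ha : a ∈ D) :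
    Tendsto (fun i => ‖PowerSeries.coeff i F‖ * ‖a‖ ^ i) atTop (𝓝 0) := by
  simpa [norm_mul, norm_pow] using (hF a ha).tendsto_atTop_zero.norm

/-- On a closed disc around `0` with a point on its boundary circle, power series without common
root are not simultaneously small. -/
lemma exists_pos_le_max_norm_eval {a : ℂ_[p]} (ha : a ≠ 0)
    (hF : Tendsto (fun i => ‖PowerSeries.coeff i F‖ * ‖a‖ ^ i) atTop (𝓝 0))
    (hG : Tendsto (fun i => ‖PowerSeries.coeff i G‖ * ‖a‖ ^ i) atTop (𝓝 0))
    (hroot : ∀ x : ℂ_[p], ‖x‖ ≤ ‖a‖ → ¬ (eval F x = 0 ∧ eval G x = 0)) :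
    ∃ c > 0, ∀ x : ℂ_[p], ‖x‖ ≤ ‖a‖ → c ≤ max ‖eval F x‖ ‖eval G x‖ := by
  have ha' : 0 < ‖a‖ := norm_pos_iff.2 ha
  by_cases hF0 : F = 0
  · have hG0 : G ≠ 0 := by
      rintro rfl
      exact hroot a le_rfl ⟨by simp [eval, hF0], by simp [eval]⟩
    obtain ⟨c, hc, h⟩ := exists_pos_le_max_of_forall_ne_zero ha' hG0 hG hF
      fun x hx h => hroot x hx h.symm
    exact ⟨c, hc, fun x hx => (h x hx).trans_eq (max_comm _ _)⟩
  · exact exists_pos_le_max_of_forall_ne_zero ha' hF0 hF hG hroot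

/-- Handles the case where the other series is zero: the norm is constant on each smaller closed
disc, hence on the open disc. -/
lemma exists_pos_le_norm_eval_of_forall_ne_zero
    (hF : ConvergesOn F (Metric.ball (0 : ℂ_[p]) 1))
    (hroot : ∀ x ∈ Metric.ball (0 : ℂ_[p]) 1, eval F x ≠ 0) :
    ∃ c > 0, ∀ x ∈ Metric.ball (0 : ℂ_[p]) 1, c ≤ ‖eval F x‖ := by
  have key : ∀ x ∈ Metric.ball (0 : ℂ_[p]) 1, ‖eval F x‖ = ‖PowerSeries.coeff 0 F‖ := by
    intro x hx
    obtain ⟨a, hxa, ha1⟩ := exists_lt_norm_lt_one (p := p) (mem_ball_zero_iff.1 hx)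
    exact norm_tsum_eq_of_forall_ne_zero ((norm_nonneg x).trans_lt hxa)
      (hF.tendsto (mem_ball_zero_iff.2 ha1))
      (fun y hy => hroot y (mem_ball_zero_iff.2 (hy.trans_lt ha1))) hxa.le
  have h0 : (0 : ℂ_[p]) ∈ Metric.ball (0 : ℂ_[p]) 1 := Metric.mem_ball_self one_pos
  exact ⟨_, key 0 h0 ▸ norm_pos_iff.2 (hroot 0 h0), fun x hx => (key x hx).ge⟩

/-- Since `-log` is injective, only finitely many radii below 1 are excluded, and these stay away
from 1. -/
lemma exists_lt_one_forall_notMem {I : Set EReal} (hI : I.Finite) :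
    ∃ t < 1, ∀ r : ℝ, t < r → r < 1 → 0 < r → ((-Real.logb p r : ℝ) : EReal) ∉ I := by
  have hfin : {r : ℝ | 0 < r ∧ r < 1 ∧ ((-Real.logb p r : ℝ) : EReal) ∈ I}.Finite := by
    refine Set.Finite.of_finite_image (f := fun r : ℝ => ((-Real.logb p r : ℝ) : EReal))
      (hI.subset ?_) ?_
    · rintro _ ⟨r, hr, rfl⟩
      exact hr.2.2
    · intro r hr r' hr' h
      exact Real.logb_injOn_pos (one_lt_natCast_prime p) hr.1 hr'.1
        (neg_injective (EReal.coe_injective h))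
  obtain ⟨ε, hε, hball⟩ := Metric.isOpen_iff.1 hfin.isClosed.isOpen_compl 1
    fun h => lt_irrefl _ h.2.1
  refine ⟨1 - ε, by linarith, fun r htr hr1 hr0 hmem => hball ?_ ⟨hr0, hr1, hmem⟩⟩
  rw [Metric.mem_ball, Real.dist_eq, abs_lt]
  constructor <;> linarith

lemma exists_pos_le_max_norm_eval_ball
    (hF : ConvergesOn F (Metric.ball (0 : ℂ_[p]) 1))
    (hG : ConvergesOn G (Metric.ball (0 : ℂ_[p]) 1))
    (hroot : ∀ x ∈ Metric.ball (0 : ℂ_[p]) 1, ¬ (eval F x = 0 ∧ eval G x = 0))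
    (hfin : (rootValuations F ∩ rootValuations G).Finite) :
    ∃ c > 0, ∀ x ∈ Metric.ball (0 : ℂ_[p]) 1, c ≤ max ‖eval F x‖ ‖eval G x‖ := by
  by_cases hF0 : F = 0
  · obtain ⟨c, hc, h⟩ := exists_pos_le_norm_eval_of_forall_ne_zero hG
      fun x hx h => hroot x hx ⟨by simp [eval, hF0], h⟩
    exact ⟨c, hc, fun x hx => le_max_of_le_right (h x hx)⟩
  by_cases hG0 : G = 0
  · obtain ⟨c, hc, h⟩ := exists_pos_le_norm_eval_of_forall_ne_zero hF
      fun x hx h => hroot x hx ⟨h, by simp [eval, hG0]⟩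
    exact ⟨c, hc, fun x hx => le_max_of_le_left (h x hx)⟩
  obtain ⟨t, ht, hnot⟩ := exists_lt_one_forall_notMem (p := p) hfin
  obtain ⟨a, hta, ha1⟩ := exists_lt_norm_lt_one (p := p) (max_lt ht one_pos)
  have ha0 : 0 < ‖a‖ := (le_max_right t 0).trans_lt hta
  have haD := mem_ball_zero_iff.2 ha1
  obtain ⟨c, hc, hcle⟩ := exists_pos_le_max_norm_eval (norm_pos_iff.1 ha0) (hF.tendsto haD)
    (hG.tendsto haD) fun x hx => hroot x (mem_ball_zero_iff.2 (hx.trans_lt ha1))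
  have hkF := norm_pos_iff.2 (PowerSeries.coeff_order hF0)
  have hkG := norm_pos_iff.2 (PowerSeries.coeff_order hG0)
  -- `c` serves the disc `‖x‖ ≤ ‖a‖`. In the annulus a nonzero term serves, as its norm does not
  -- decrease when `‖x‖` grows; the order merely picks a nonzero coefficient.
  refine ⟨min c (min (‖PowerSeries.coeff F.order.toNat F‖ * ‖a‖ ^ F.order.toNat)
    (‖PowerSeries.coeff G.order.toNat G‖ * ‖a‖ ^ G.order.toNat)), by positivity, fun x hx => ?_⟩
  rcases le_or_gt ‖x‖ ‖a‖ with hxa | hxa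
  · exact (min_le_left _ _).trans (hcle x hxa)
  refine (min_le_right _ _).trans ?_
  have hx0 : x ≠ 0 := norm_pos_iff.1 (ha0.trans hxa)
  have hmem := hnot ‖x‖ ((le_max_left t 0).trans_lt (hta.trans hxa)) (mem_ball_zero_iff.1 hx)
    (ha0.trans hxa)
  by_cases hmF : ((-Real.logb p ‖x‖ : ℝ) : EReal) ∈ rootValuations F
  · have h := norm_coeff_mul_pow_le_norm_eval hx0 (hG.tendsto hx) (fun h => hmem ⟨hmF, h⟩)
      G.order.toNat
    refine (min_le_right _ _).trans (le_max_of_le_right (le_trans ?_ h))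
    gcongr
  · have h := norm_coeff_mul_pow_le_norm_eval hx0 (hF.tendsto hx) hmF F.order.toNat
    refine (min_le_left _ _).trans (le_max_of_le_left (le_trans ?_ h))
    gcongr

lemma supPhi_lt_top_of_le_max {D : Set ℂ_[p]} {c : ℝ} (hc : 0 < c)
    (h : ∀ x ∈ D, c ≤ max ‖eval F x‖ ‖eval G x‖) : supPhi F G D < ⊤ := by
  refine lt_of_le_of_lt (iSup₂_le fun x hx => ?_) (EReal.coe_lt_top (-Real.logb p c))
  rcases le_max_iff.1 (h x hx) with hle | hle
  · exact (min_le_left _ _).trans (vp_le_of_le_norm hc hle)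
  · exact (min_le_right _ _).trans (vp_le_of_le_norm hc hle)

end Discs

end PadicSeries

theorem proposition5p2 (p : ℕ) [Fact p.Prime] (F G : PowerSeries ℂ_[p])
    (D : Set ℂ_[p])
    (hD : D = Metric.ball (0 : ℂ_[p]) 1 ∨ D = Metric.closedBall (0 : ℂ_[p]) 1)
    (hF : PadicSeries.ConvergesOn F D) (hG : PadicSeries.ConvergesOn G D)
    (hroot : ∀ x ∈ D, ¬ (PadicSeries.eval F x = 0 ∧ PadicSeries.eval G x = 0))
    (hfin : (PadicSeries.rootValuations F ∩ PadicSeries.rootValuations G).Finite) :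
    PadicSeries.supPhi F G D < ⊤ := by
  rcases hD with rfl | rfl
  · obtain ⟨c, hc, h⟩ := PadicSeries.exists_pos_le_max_norm_eval_ball hF hG hroot hfin
    exact PadicSeries.supPhi_lt_top_of_le_max hc h
  · have h1 : (1 : ℂ_[p]) ∈ Metric.closedBall (0 : ℂ_[p]) 1 := by simp
    obtain ⟨c, hc, h⟩ := PadicSeries.exists_pos_le_max_norm_eval one_ne_zero (hF.tendsto h1)
      (hG.tendsto h1) fun x hx => hroot x (by simpa using hx)
    exact PadicSeries.supPhi_lt_top_of_le_max hc fun x hx => h x (by simpa using hx)
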